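/- For $n,k\ge 0$ let $\mathcal F_{n,k}$ be the set of forests of rooted labelled trees on the vertex set $[n]=\{1,\dots,n\}$ with $k$ components. For $F\in\mathcal F_{n,k}$ let $V_r(F)$ be its set of roots, with elements $v_0<v_1<\dots<v_{k-1}$. If $F$ has a nonroot vertex, let $v_{\min}$ be the lowest-numbered vertex among all vertices whose parent is a root, and let $\mathrm{scindex}(F)$ be the $j$ for which $v_j$ is the parent of $v_{\min}$ (put $\mathrm{scindex}(F)=0$ if there is no nonroot vertex). Let $V_t(F)$ be the set of vertices that are neither a root nor $v_{\min}$. Put $$\mathrm{niblings}(F)=\sum_{v\in V_r(F)}\#\{v'\in[n]:v'\notin V_r(F),\ v'<v\},\qquad \mathrm{parents}(F)=\sum_{v\in V_t(F)}\mathrm{parent}(v),$$ where $\mathrm{parent}(v)$ is the label of the parent of $v$. In variables $r,s,t$, give a root $v$ the weight $r^{\#\{v'\notin V_r(F):\,v'<v\}}$, the vertex $v_{\min}$ the weight $s^{\mathrm{scindex}(F)}$, and a vertex $v\in V_t(F)$ the weight $t^{\mathrm{parent}(v)-1}$; let $\mathrm{wt}(F)=\mathrm{wt}_{r,s,t}(F)$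 be the product of the weights of all vertices of $F$. Write $[m]_q=1+q+\dots+q^{m-1}$, $[m]_q!=\prod_{j=1}^m[j]_q$ and $\binom{m}{l}_q=\frac{[m]_q!}{[l]_q!\,[m-l]_q!}$, a polynomial in $q$ for $0\le l\le m$. Let $f_{n,0}(q)=\delta_{n0}$, $f_{n,k}(q)=\binom{n-1}{k-1}_q([n]_q)^{n-k}$ for $n\ge k\ge1$, and $f_{n,k}(q)=0$ for $k>n$. **Proposition.** Let $n>k\ge 0$. For every $F\in\mathcal F_{n,k}$ we have $\mathrm{parents}(F)-n+k+1\ge0$ and $\mathrm{wt}(F)=r^{\mathrm{niblings}(F)}s^{\mathrm{scindex}(F)}t^{\mathrm{parents}(F)-n+k+1}$, and $$\sum_{F\in\mathcal F_{n,k}} r^{\mathrm{niblings}(F)}\,s^{\mathrm{scindex}(F)}\,t^{\mathrm{parents}(F)-n+k+1}=\binom{n}{k}_r\,[k]_s\,([n]_t)^{n-k-1}.$$ In particular, for $r=s=t=q$, $$f_{n,k}(q)=\sum_{F\in\mathcal F_{n,k}}q^{\mathrm{niblings}(F)+\mathrm{scindex}(F)+\mathrm{parents}(F)-n+k+1}.$$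 Moreover $f_{n,k}(q)=\sum_{F\in\mathcal F_{n,k}}\mathrm{wt}_{q,q,q}(F)$ for all $n,k\ge 0$. All identities hold for arbitrary elements $r,s,t,q$ of any commutative ring, in particular as polynomial identities over $\mathbb Z$. -/

import Mathlib

/-- A forest of rooted labelled trees on `[n]`, given by its parent map: the element `v : Fin n` is
the vertex with label `v + 1`, `parent v = none` says that `v` is a root, `parent v = some u` says
that `u` is the parent of `v`, and no vertex is a proper ancestor of itself. -/
@[ext]
structure RootedForest (n : ℕ) where
  parent : Fin n → Option (Fin n)
  acyclic : ∀ v, ¬ Relation.TransGen (fun a b => parent a = some b) v v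

noncomputable instance (n : ℕ) : Fintype (RootedForest n) :=
  Fintype.ofInjective RootedForest.parent fun _ _ h => RootedForest.ext h

namespace RootedForest

/-- The set `V_r(F)` of roots. -/
def roots {n : ℕ} (F : RootedForest n) : Finset (Fin n) :=
  Finset.univ.filter fun v => F.parent v = none

/-- The underlying undirected graph. -/
def graph {n : ℕ} (F : RootedForest n) : SimpleGraph (Fin n) :=
  SimpleGraph.fromRel fun a b => F.parent a = some b

/-- The number of components of the forest. -/
noncomputable def components {n : ℕ} (F : RootedForest n) : ℕ :=
  Nat.card F.graph.ConnectedComponent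

/-- Each component contains exactly one root. -/
theorem components_eq_card_roots {n : ℕ} (F : RootedForest n) :
    F.components = F.roots.card := by
  have hadj : ∀ a b, F.parent a = some b → F.graph.Adj a b := by
    intro a b hab
    refine ⟨?_, Or.inl hab⟩
    rintro rfl
    exact F.acyclic a (Relation.TransGen.single hab)
  have hinv : ∀ a b ρ, F.parent ρ = none → F.graph.Adj a b →
      Relation.ReflTransGen (fun a b => F.parent a = some b) a ρ →
      Relation.ReflTransGen (fun a b => F.parent a = some b) b ρ := by
    intro a b ρ hρ hab h
    rcases hab.2 with h1 | h1
    · rcases h.cases_head with h2 | ⟨c, hc, h2⟩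
      · subst h2
        rw [hρ] at h1
        cases h1
      · have hcb : c = b := Option.some.inj (hc.symm.trans h1)
        exact hcb ▸ h2
    · exact Relation.ReflTransGen.head h1 h
  have hwf : WellFounded (fun b a : Fin n =>
      Relation.TransGen (fun a b => F.parent a = some b) a b) := by
    have : IsTrans (Fin n) (fun b a : Fin n =>
        Relation.TransGen (fun a b => F.parent a = some b) a b) :=
      ⟨fun _ _ _ h1 h2 => h2.trans h1⟩
    have : Std.Irrefl (fun b a : Fin n =>
        Relation.TransGen (fun a b => F.parent a = some b) a b) :=
      ⟨fun a => F.acyclic a⟩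
    exact Finite.wellFounded_of_trans_of_irrefl _
  have hex : ∀ v, ∃ ρ, F.parent ρ = none ∧ F.graph.Reachable ρ v := by
    intro v
    induction v using hwf.induction with
    | _ v ih =>
      cases hv : F.parent v with
      | none => exact ⟨v, hv, SimpleGraph.Reachable.refl v⟩
      | some u =>
        obtain ⟨ρ, hρ, h⟩ := ih u (Relation.TransGen.single hv)
        exact ⟨ρ, hρ, h.trans (hadj v u hv).symm.reachable⟩
  have hbij : Function.Bijective
      (fun ρ : F.roots => F.graph.connectedComponentMk ρ.1) := by
    constructor
    · rintro ⟨a, ha⟩ ⟨b, hb⟩ hab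
      have ha' : F.parent a = none := by simpa [roots] using ha
      have hb' : F.parent b = none := by simpa [roots] using hb
      obtain ⟨w⟩ := SimpleGraph.ConnectedComponent.exact hab
      have key : ∀ x y : Fin n, F.graph.Walk x y →
          Relation.ReflTransGen (fun a b => F.parent a = some b) x a →
          Relation.ReflTransGen (fun a b => F.parent a = some b) y a := by
        intro x y w
        induction w with
        | nil => exact id
        | cons h _ ih => exact fun hx => ih (hinv _ _ a ha' h hx)
      rcases (key a b w Relation.ReflTransGen.refl).cases_head with h2 | ⟨c, hc, _⟩
      · exact Subtype.ext h2.symm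
      · rw [hb'] at hc
        cases hc
    · intro c
      induction c using SimpleGraph.ConnectedComponent.ind with
      | _ v =>
        obtain ⟨ρ, hρ, h⟩ := hex v
        exact ⟨⟨ρ, by simpa [roots] using hρ⟩, SimpleGraph.ConnectedComponent.sound h⟩
  rw [components, ← Nat.card_eq_of_bijective _ hbij]
  simp

/-- The set `𝓕_{n,k}` of forests on `[n]` with `k` components. -/
noncomputable def withComponents (n k : ℕ) : Finset (RootedForest n) :=
  Finset.univ.filter fun F => F.components = k

/-- The label in `{1, …, n}` of the parent of `v` (and `0` if `v` is a root). -/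
def parentLabel {n : ℕ} (F : RootedForest n) (v : Fin n) : ℕ :=
  (F.parent v).elim 0 fun u => (u : ℕ) + 1

/-- `V_r(F, v)`: the nonroot vertices that are lower-numbered than `v`. -/
def lowerNonroots {n : ℕ} (F : RootedForest n) (v : Fin n) : Finset (Fin n) :=
  Finset.univ.filter fun w => w ∉ F.roots ∧ w < v

/-- `niblings(F)`. -/
def niblings {n : ℕ} (F : RootedForest n) : ℕ :=
  ∑ v ∈ F.roots, (F.lowerNonroots v).card

/-- The vertices whose parent is a root. -/
def rootChildren {n : ℕ} (F : RootedForest n) : Finset (Fin n) :=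
  Finset.univ.filter fun v => ∃ u ∈ F.roots, F.parent v = some u

/-- `V_s(F)`: the set `{v_min}`, where `v_min` is the lowest-numbered vertex among all children of
roots; it is empty when every vertex is a root. -/
def minRootChild {n : ℕ} (F : RootedForest n) : Finset (Fin n) :=
  F.rootChildren.filter fun v => ∀ w ∈ F.rootChildren, v ≤ w

/-- `V_t(F)`: the vertices that are neither a root nor `v_min`. -/
def otherVertices {n : ℕ} (F : RootedForest n) : Finset (Fin n) :=
  Finset.univ.filter fun v => v ∉ F.roots ∧ v ∉ F.minRootChild

/-- `scindex(F)`: if `v_0 < v_1 < ⋯ < v_{k-1}` are the roots, the `j` for which `v_j` is the parent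
of `v_min`, that is, the number of roots that are lower-numbered than this parent. (The outer sum
has only the term `v = v_min`, and none if `v_min` does not exist.) -/
def scindex {n : ℕ} (F : RootedForest n) : ℕ :=
  ∑ v ∈ F.minRootChild, (F.roots.filter fun u : Fin n => (u : ℕ) + 1 < F.parentLabel v).card

/-- `parents(F)`: the sum of the labels of the parents of the vertices in `V_t(F)`. -/
def parents {n : ℕ} (F : RootedForest n) : ℕ :=
  ∑ v ∈ F.otherVertices, F.parentLabel v

/-- The weight of a vertex. -/
def vertexWeight {R : Type*} [CommRing R] {n : ℕ} (r s t : R) (F : RootedForest n)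
    (v : Fin n) : R :=
  if v ∈ F.roots then r ^ (F.lowerNonroots v).card
  else if v ∈ F.minRootChild then s ^ F.scindex
  else t ^ (F.parentLabel v - 1)

/-- The weight of a forest: the product of the weights of its vertices. -/
def weight {R : Type*} [CommRing R] {n : ℕ} (r s t : R) (F : RootedForest n) : R :=
  ∏ v, F.vertexWeight r s t v

end RootedForest

/-- `[n]_q = 1 + q + ⋯ + q^(n-1)`. -/
def qNumber {R : Type*} [CommRing R] (q : R) (n : ℕ) : R :=
  ∑ i ∈ Finset.range n, q ^ i

/-- `[n]_q! = [1]_q [2]_q ⋯ [n]_q`. -/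
def qFactorial {R : Type*} [CommRing R] (q : R) (n : ℕ) : R :=
  ∏ j ∈ Finset.range n, qNumber q (j + 1)

/-- The `q`-binomial coefficient `[n]_q! / ([k]_q! [n-k]_q!)` as a polynomial in `q`, for `k ≤ n`;
the denominator is monic and divides the numerator in `ℤ[q]`. -/
noncomputable def qBinomialPoly (n k : ℕ) : Polynomial ℤ :=
  qFactorial Polynomial.X n /ₘ (qFactorial Polynomial.X k * qFactorial Polynomial.X (n - k))

theorem qFactorial_X_monic (n : ℕ) : (qFactorial (Polynomial.X : Polynomial ℤ) n).Monic :=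
  Polynomial.monic_prod_of_monic _ _ fun _ _ => Polynomial.monic_geom_sum_X (Nat.succ_ne_zero _)

/-- The division in the definition of the `q`-binomial coefficient is exact. -/
theorem qBinomialPoly_mul {n k : ℕ} (h : k ≤ n) :
    qBinomialPoly n k * (qFactorial Polynomial.X k * qFactorial Polynomial.X (n - k)) =
      qFactorial Polynomial.X n := by
  have hdvd : ∀ a b : ℕ, qFactorial (Polynomial.X : Polynomial ℤ) a * qFactorial Polynomial.X b ∣
      qFactorial Polynomial.X (a + b) := by
    have hsucc : ∀ m, qFactorial (Polynomial.X : Polynomial ℤ) (m + 1) =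
        qFactorial Polynomial.X m * qNumber Polynomial.X (m + 1) := fun m =>
      Finset.prod_range_succ _ _
    intro a
    induction a with
    | zero => intro b; simp [qFactorial]
    | succ a iha =>
      intro b
      induction b with
      | zero => simp [qFactorial]
      | succ b ihb =>
        have hsum : qNumber (Polynomial.X : Polynomial ℤ) (a + 1 + (b + 1)) =
            qNumber Polynomial.X (a + 1) +
              Polynomial.X ^ (a + 1) * qNumber Polynomial.X (b + 1) := by
          rw [qNumber, Finset.sum_range_add, qNumber, qNumber, Finset.mul_sum]
          simp only [pow_add]
        obtain ⟨c, hc⟩ := iha (b + 1)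
        obtain ⟨d, hd⟩ := ihb
        have e1 : a + (b + 1) = a + 1 + b := by ring
        rw [e1] at hc
        refine ⟨c + Polynomial.X ^ (a + 1) * d, ?_⟩
        rw [show a + 1 + (b + 1) = (a + 1 + b) + 1 by ring, hsucc (a + 1 + b),
          show a + 1 + b + 1 = a + 1 + (b + 1) by ring, hsum, mul_add]
        nth_rewrite 1 [hc]
        rw [hd, hsucc a, hsucc b]
        ring
  have hm := (qFactorial_X_monic k).mul (qFactorial_X_monic (n - k))
  have hd := hdvd k (n - k)
  rw [Nat.add_sub_cancel' h] at hd
  have h1 := Polynomial.modByMonic_add_div (qFactorial (Polynomial.X : Polynomial ℤ) n)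
    (qFactorial Polynomial.X k * qFactorial Polynomial.X (n - k))
  rw [(Polynomial.modByMonic_eq_zero_iff_dvd hm).2 hd, zero_add] at h1
  rw [mul_comm]
  exact h1

/-- The `q`-binomial coefficient, for `q` in a commutative ring. -/
noncomputable def qBinomial {R : Type*} [CommRing R] (q : R) (n k : ℕ) : R :=
  Polynomial.aeval q (qBinomialPoly n k)

/-- The `(n, k)` entry `f_{n,k}(q)` of the `q`-forests matrix. -/
noncomputable def qForestsEntry {R : Type*} [CommRing R] (q : R) (n k : ℕ) : R :=
  if k = 0 then (if n = k then 1 else 0)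
  else if k ≤ n then qBinomial q (n - 1) (k - 1) * qNumber q n ^ (n - k)
  else 0

/-! Sort the forests by root set `S`, with complement `T`. The root weights give `r` to the number
of inversions between `S` and `T`, and summing this over `k`-subsets `S` yields the `q`-binomial
(`inversionSum_eq_qBinomial`).

For fixed `S`, sort by the set `C` of root children: a forest is an arbitrary map `C → S` together
with a forest on `T` with root set `C` (`sum_forestMaps_filter_childrenOf`). If a parent `u` weighs
`x u`, write `x(A)` for the sum of `x` over `A`. Each child in `C` contributes `x(S)`, except that
the least one contributes `[k]_s`, because its parent's index runs over `0, …, k-1`. Without this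
exception, induction gives `x(S) (x(S) + x(T)) ^ (|T| - 1)`, the sum over `C` being a binomial
expansion (`sum_pow_mul_forestSum`). The exception only replaces the leading `x(S)` by `[k]_s`. With
`x u = t ^ (label - 1)` the total `x(S) + x(T)` is `[n]_t`.

At `r = s = t = q`, absorption turns the product into `f_{n,k}(q)`. -/

/-! ### `q`-numbers and `q`-binomial coefficients -/

theorem qNumber_zero {R : Type*} [CommRing R] (q : R) : qNumber q 0 = 0 := by simp [qNumber]

theorem qNumber_add {R : Type*} [CommRing R] (q : R) (a b : ℕ) :
    qNumber q (a + b) = qNumber q a + q ^ a * qNumber q b := by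
  simp only [qNumber, Finset.sum_range_add, Finset.mul_sum, pow_add]

theorem qFactorial_succ {R : Type*} [CommRing R] (q : R) (n : ℕ) :
    qFactorial q (n + 1) = qFactorial q n * qNumber q (n + 1) :=
  Finset.prod_range_succ _ _

theorem qBinomialPoly_eq_of_mul {n k : ℕ} (h : k ≤ n) {P : Polynomial ℤ}
    (hP : P * (qFactorial Polynomial.X k * qFactorial Polynomial.X (n - k)) =
      qFactorial Polynomial.X n) : qBinomialPoly n k = P :=
  mul_right_cancel₀ ((qFactorial_X_monic k).mul (qFactorial_X_monic (n - k))).ne_zero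
    ((qBinomialPoly_mul h).trans hP.symm)

theorem qBinomial_self {R : Type*} [CommRing R] (q : R) (n : ℕ) : qBinomial q n n = 1 := by
  rw [qBinomial, qBinomialPoly_eq_of_mul le_rfl (P := 1) (by simp [qFactorial]), map_one]

/-- The absorption identity for `q`-binomial coefficients. -/
theorem qBinomial_succ_mul_qNumber {R : Type*} [CommRing R] (q : R) {n k : ℕ} (h : k ≤ n) :
    qBinomial q (n + 1) (k + 1) * qNumber q (k + 1) = qBinomial q n k * qNumber q (n + 1) := by
  have key : qBinomialPoly (n + 1) (k + 1) * qNumber Polynomial.X (k + 1) =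
      qBinomialPoly n k * qNumber Polynomial.X (n + 1) := by
    refine mul_right_cancel₀ ((qFactorial_X_monic k).mul (qFactorial_X_monic (n - k))).ne_zero ?_
    have h1 := qBinomialPoly_mul (Nat.succ_le_succ h)
    have h2 := qBinomialPoly_mul h
    simp only [Nat.succ_eq_add_one, Nat.add_sub_add_right, qFactorial_succ] at h1
    linear_combination h1 - qNumber Polynomial.X (n + 1) * h2
  have := congrArg (Polynomial.aeval q) key
  simpa [qBinomial, qNumber] using this

/-! ### Ranks and inversions of subsets -/

theorem sum_pow_card_filter_lt {α R : Type*} [LinearOrder α] [CommRing R] (q : R) (A : Finset α) :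
    ∑ u ∈ A, q ^ (A.filter (· < u)).card = qNumber q A.card := by
  induction A using Finset.induction_on_max with
  | empty => simp [qNumber]
  | insert a A ha ih =>
    have hna : a ∉ A := fun h => lt_irrefl _ (ha a h)
    rw [Finset.sum_insert hna, Finset.card_insert_of_notMem hna, qNumber, Finset.sum_range_succ,
      ← qNumber, ← ih, add_comm]
    congr 1
    · refine Finset.sum_congr rfl fun u hu => ?_
      rw [Finset.filter_insert, if_neg (ha u hu).not_gt]
    · rw [Finset.filter_insert, if_neg (lt_irrefl a), Finset.filter_true_of_mem ha]

/-- The inversion generating function of the `k`-element subsets of `A`. -/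
def inversionSum {α R : Type*} [LinearOrder α] [CommRing R] (q : R) (A : Finset α) (k : ℕ) : R :=
  ∑ S ∈ A.powersetCard k, q ^ ∑ v ∈ S, ((A \ S).filter (· < v)).card

theorem inversionSum_zero {α R : Type*} [LinearOrder α] [CommRing R] (q : R) (A : Finset α) :
    inversionSum q A 0 = 1 := by simp [inversionSum]

/-- The `q`-Pascal rule: a maximal element left out of the subset creates no inversion, while one
put in exceeds all `|A| - k` omitted elements. -/
theorem inversionSum_insert {α R : Type*} [LinearOrder α] [CommRing R] (q : R) {A : Finset α}
    {a : α} (ha : ∀ x ∈ A, x < a) (k : ℕ) :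
    inversionSum q (insert a A) (k + 1) =
      inversionSum q A (k + 1) + q ^ (A.card - k) * inversionSum q A k := by
  have hna : a ∉ A := fun h => lt_irrefl _ (ha a h)
  rw [inversionSum, Finset.powersetCard_succ_insert hna, Finset.sum_union, Finset.sum_image]
  · congr 1
    · refine Finset.sum_congr rfl fun S hS => ?_
      have hSA := (Finset.mem_powersetCard.1 hS).1
      congr 1
      refine Finset.sum_congr rfl fun v hv => ?_
      rw [Finset.insert_sdiff_of_notMem _ (fun h => hna (hSA h)), Finset.filter_insert,
        if_neg (ha v (hSA hv)).not_gt]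
    · rw [inversionSum, Finset.mul_sum]
      refine Finset.sum_congr rfl fun S hS => ?_
      obtain ⟨hSA, hc⟩ := Finset.mem_powersetCard.1 hS
      have haS : a ∉ S := fun h => hna (hSA h)
      have hs : insert a A \ insert a S = A \ S := by
        ext x
        simp only [Finset.mem_sdiff, Finset.mem_insert]
        constructor
        · tauto
        · rintro ⟨h1, h2⟩
          refine ⟨Or.inr h1, ?_⟩
          rintro (rfl | h)
          · exact hna h1
          · exact h2 h
      rw [hs, Finset.sum_insert haS, pow_add, Finset.filter_true_of_mem
        (fun x hx => ha x (Finset.mem_sdiff.1 hx).1), Finset.card_sdiff_of_subset hSA, hc]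
  · intro S hS S' hS' h
    have h1 : a ∉ S := fun h => hna ((Finset.mem_powersetCard.1 hS).1 h)
    have h2 : a ∉ S' := fun h => hna ((Finset.mem_powersetCard.1 hS').1 h)
    rw [← Finset.erase_insert h1, ← Finset.erase_insert h2]
    exact congrArg (fun s => Finset.erase s a) h
  · rw [Finset.disjoint_left]
    intro S hS hS'
    obtain ⟨S', -, rfl⟩ := Finset.mem_image.1 hS'
    exact hna ((Finset.mem_powersetCard.1 hS).1 (Finset.mem_insert_self _ _))

theorem inversionSum_mul_qFactorial {α R : Type*} [LinearOrder α] [CommRing R] (q : R)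
    (A : Finset α) : ∀ {k : ℕ}, k ≤ A.card →
      inversionSum q A k * (qFactorial q k * qFactorial q (A.card - k)) =
        qFactorial q A.card := by
  induction A using Finset.induction_on_max with
  | empty =>
    intro k hk
    obtain rfl : k = 0 := by simpa using hk
    simp [inversionSum_zero, qFactorial]
  | insert a A ha ih =>
    intro k hk
    have hna : a ∉ A := fun h => lt_irrefl _ (ha a h)
    rw [Finset.card_insert_of_notMem hna] at hk ⊢
    cases k with
    | zero => simp [inversionSum_zero, qFactorial]
    | succ k =>
      have h2 := ih (Nat.le_of_succ_le_succ hk)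
      rw [inversionSum_insert q ha, Nat.add_sub_add_right]
      -- If `k = |A|`, no subset of `A` has `k + 1` elements and only the second Pascal term
      -- survives.
      rcases (Nat.le_of_succ_le_succ hk).eq_or_lt with h | h
      · have h0 : inversionSum q A (k + 1) = 0 := by
          rw [inversionSum, Finset.powersetCard_eq_empty.2 (by omega), Finset.sum_empty]
        rw [h0, qFactorial_succ q k, qFactorial_succ q A.card, ← h2, h]
        simp
        ring
      · have h1 := ih (Nat.succ_le_of_lt h)
        obtain ⟨m, hm⟩ : ∃ m, A.card = k + 1 + m := ⟨A.card - (k + 1), by omega⟩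
        have e1 : A.card - k = m + 1 := by omega
        have e2 : A.card - (k + 1) = m := by omega
        have e3 : A.card + 1 = (m + 1) + (k + 1) := by omega
        simp only [Nat.succ_eq_add_one, e1, e2] at h1 h2 ⊢
        rw [qFactorial_succ q A.card, e3, qNumber_add]
        rw [qFactorial_succ] at h1 h2 ⊢
        rw [qFactorial_succ]
        linear_combination qNumber q (m + 1) * h1 + q ^ (m + 1) * qNumber q (k + 1) * h2

theorem inversionSum_eq_qBinomial {α R : Type*} [LinearOrder α] [CommRing R] (q : R)
    (A : Finset α) {k : ℕ} (hk : k ≤ A.card) : inversionSum q A k = qBinomial q A.card k := by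
  -- The factorials can be cancelled over `ℤ[X]`, though not in a general ring; evaluation at `q`
  -- follows.
  rw [qBinomial, qBinomialPoly_eq_of_mul hk (inversionSum_mul_qFactorial Polynomial.X A hk)]
  simp [inversionSum]

/-! ### The binomial identity behind the recursion -/

/-- Double counting: deleting `v` matches the subsets containing `v` with the `c`-subsets of
`T.erase v`. -/
theorem sum_powersetCard_sum {V R : Type*} [DecidableEq V] [CommRing R] (T : Finset V) (x : V → R) (c : ℕ) :
    ∑ C ∈ T.powersetCard (c + 1), ∑ v ∈ C, x v =
      (T.card - 1).choose c • ∑ v ∈ T, x v := by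
  have h : ∀ C ∈ T.powersetCard (c + 1), ∑ v ∈ C, x v = ∑ v ∈ T, if v ∈ C then x v else 0 := by
    intro C hC
    rw [← Finset.sum_filter, Finset.filter_mem_eq_inter,
      Finset.inter_eq_right.2 (Finset.mem_powersetCard.1 hC).1]
  rw [Finset.sum_congr rfl h, Finset.sum_comm, Finset.smul_sum]
  refine Finset.sum_congr rfl fun v hv => ?_
  rw [← Finset.sum_filter, Finset.sum_const]
  congr 1
  rw [← Finset.card_erase_of_mem hv, ← Finset.card_powersetCard]
  refine Finset.card_bij' (fun C _ => C.erase v) (fun C _ => insert v C) ?_ ?_ ?_ ?_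
  · intro C hC
    obtain ⟨hC, hvC⟩ := Finset.mem_filter.1 hC
    obtain ⟨h1, h2⟩ := Finset.mem_powersetCard.1 hC
    exact Finset.mem_powersetCard.2 ⟨Finset.erase_subset_erase v h1, by
      rw [Finset.card_erase_of_mem hvC, h2, Nat.add_sub_cancel]⟩
  · intro C hC
    obtain ⟨h1, h2⟩ := Finset.mem_powersetCard.1 hC
    have hvC : v ∉ C := fun h => Finset.notMem_erase v T (h1 h)
    refine Finset.mem_filter.2 ⟨Finset.mem_powersetCard.2 ⟨?_, ?_⟩, Finset.mem_insert_self _ _⟩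
    · exact Finset.insert_subset hv (h1.trans (Finset.erase_subset _ _))
    · rw [Finset.card_insert_of_notMem hvC, h2]
  · intro C hC
    exact Finset.insert_erase (Finset.mem_filter.1 hC).2
  · intro C hC
    exact Finset.erase_insert fun h => Finset.notMem_erase v T ((Finset.mem_powersetCard.1 hC).1 h)

/-- The weight enumerator of forests with nonroot set `T`, in closed form. -/
def forestSum {V R : Type*} [DecidableEq V] [CommRing R] (x : V → R) (S T : Finset V) : R :=
  if T = ∅ then 1 else (∑ u ∈ S, x u) * (∑ u ∈ S, x u + ∑ u ∈ T, x u) ^ (T.card - 1)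

/-- Since `x(C) + x(T \ C) = x(T)`, for `|C| = c + 1` only the linear factor `x(C)` depends on `C`.
Double counting then produces the `c`-th term of the binomial expansion. -/
theorem sum_pow_mul_forestSum {V R : Type*} [DecidableEq V] [CommRing R] (x : V → R) (a : R) {T : Finset V}
    (hT : T.Nonempty) :
    ∑ C ∈ T.powerset.filter (·.Nonempty), a ^ (C.card - 1) * forestSum x C (T \ C) =
      (a + ∑ u ∈ T, x u) ^ (T.card - 1) := by
  obtain ⟨m, hm⟩ : ∃ m, T.card = m + 1 := ⟨T.card - 1, by have := hT.card_pos; omega⟩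
  have hmaps : ∀ C ∈ T.powerset.filter (·.Nonempty), C.card - 1 ∈ Finset.range (m + 1) := by
    intro C hC
    have := Finset.card_le_card (Finset.mem_powerset.1 (Finset.mem_filter.1 hC).1)
    rw [Finset.mem_range]
    omega
  rw [← Finset.sum_fiberwise_of_maps_to hmaps, hm, Nat.add_sub_cancel, add_pow]
  refine Finset.sum_congr rfl fun c hc => ?_
  have hset : (T.powerset.filter (·.Nonempty)).filter (fun C => C.card - 1 = c) =
      T.powersetCard (c + 1) := by
    ext C
    simp only [Finset.mem_filter, Finset.mem_powerset, Finset.mem_powersetCard,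
      ← Finset.card_pos]
    exact ⟨fun h => ⟨h.1.1, by omega⟩, fun h => ⟨⟨h.1, by omega⟩, by omega⟩⟩
  rw [hset]
  -- The top term is `C = T`, where `forestSum` takes its exceptional value `1`.
  rcases (Nat.le_of_lt_succ (Finset.mem_range.1 hc)).eq_or_lt with rfl | hlt
  · rw [← hm, Finset.powersetCard_self]
    simp [forestSum, hm]
  · have h : ∀ C ∈ T.powersetCard (c + 1), a ^ (C.card - 1) * forestSum x C (T \ C) =
        a ^ c * (∑ u ∈ T, x u) ^ (m - c - 1) * ∑ u ∈ C, x u := by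
      intro C hC
      obtain ⟨h1, h2⟩ := Finset.mem_powersetCard.1 hC
      have hne : T \ C ≠ ∅ := by
        rw [← Finset.card_pos.trans Finset.nonempty_iff_ne_empty,
          Finset.card_sdiff_of_subset h1]
        omega
      have hsum : ∑ u ∈ C, x u + ∑ u ∈ T \ C, x u = ∑ u ∈ T, x u := by
        rw [add_comm, Finset.sum_sdiff h1]
      have hcard : (T \ C).card = m - c := by
        rw [Finset.card_sdiff_of_subset h1]
        omega
      rw [forestSum, if_neg hne, hsum, hcard, h2, Nat.add_sub_cancel]
      ring
    rw [Finset.sum_congr rfl h, ← Finset.mul_sum, sum_powersetCard_sum, hm, Nat.add_sub_cancel,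
      nsmul_eq_mul]
    obtain ⟨e, he⟩ : ∃ e, m - c = e + 1 := ⟨m - c - 1, by omega⟩
    rw [he, Nat.add_sub_cancel, pow_succ]
    ring

/-! ### Parent maps with prescribed root set -/

section ForestMaps

variable {V : Type*} [Fintype V] [DecidableEq V]

open Classical in
/-- The parent maps of forests on the vertex set `S ∪ T` with root set `S`: the map is defined
exactly on `T`, and some rank function decreases towards the roots. -/
noncomputable def forestMaps (S T : Finset V) : Finset (V → Option V) :=
  Finset.univ.filter fun p => (∀ v, p v = none ↔ v ∉ T) ∧ (∀ v u, p v = some u → u ∈ S ∪ T) ∧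
    ∃ d : V → ℕ, ∀ a b, p a = some b → d b < d a

/-- The vertices whose parent lies in `S`. -/
def childrenOf (S : Finset V) (p : V → Option V) : Finset V :=
  Finset.univ.filter fun v => ∃ u ∈ S, p v = some u

theorem mem_forestMaps {S T : Finset V} {p : V → Option V} :
    p ∈ forestMaps S T ↔ (∀ v, p v = none ↔ v ∉ T) ∧ (∀ v u, p v = some u → u ∈ S ∪ T) ∧
      ∃ d : V → ℕ, ∀ a b, p a = some b → d b < d a := by
  simp [forestMaps]

theorem mem_childrenOf {S : Finset V} {p : V → Option V} {v : V} :
    v ∈ childrenOf S p ↔ ∃ u ∈ S, p v = some u := by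
  simp [childrenOf]

theorem childrenOf_subset {S T : Finset V} {p : V → Option V} (hp : p ∈ forestMaps S T) :
    childrenOf S p ⊆ T := by
  intro v hv
  obtain ⟨u, -, hu⟩ := mem_childrenOf.1 hv
  by_contra h
  rw [((mem_forestMaps.1 hp).1 v).2 h] at hu
  cases hu

/-- A vertex of minimal rank in `T` cannot have its parent in `T`. -/
theorem childrenOf_nonempty {S T : Finset V} {p : V → Option V} (hp : p ∈ forestMaps S T)
    (hT : T.Nonempty) : (childrenOf S p).Nonempty := by
  obtain ⟨h1, h2, d, hd⟩ := mem_forestMaps.1 hp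
  obtain ⟨v, hv, hmin⟩ := T.exists_min_image d hT
  cases hpv : p v with
  | none => exact absurd hv ((h1 v).1 hpv)
  | some u =>
    refine ⟨v, mem_childrenOf.2 ⟨u, ?_, hpv⟩⟩
    rcases Finset.mem_union.1 (h2 v u hpv) with h | h
    · exact h
    · exact absurd (hd v u hpv) (hmin u h).not_gt

theorem forestMaps_empty (S : Finset V) : forestMaps S ∅ = {fun _ => none} := by
  ext p
  rw [mem_forestMaps, Finset.mem_singleton]
  constructor
  · rintro ⟨h, -⟩
    funext v
    exact (h v).2 (Finset.notMem_empty v)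
  · rintro rfl
    simp

/-- Forests whose set of root children is `C` arise by attaching the elements of `C` to roots
in a forest with root set `C`. -/
theorem sum_forestMaps_filter_childrenOf {R : Type*} [CommRing R] {S T C : Finset V}
    (hST : Disjoint S T) (hCT : C ⊆ T) (w : V → Option V → R) (hw : ∀ v, w v none = 1) :
    ∑ p ∈ (forestMaps S T).filter (fun p => childrenOf S p = C), ∏ v, w v (p v) =
      (∏ v ∈ C, ∑ u ∈ S, w v (some u)) *
        ∑ p ∈ forestMaps C (T \ C), ∏ v, w v (p v) := by
  -- Maps `C → S` are extended by `none` outside `C`, so that the product of sums expands over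
  -- `Fintype.piFinset t`.
  let t : V → Finset (Option V) := fun v => if v ∈ C then S.map Function.Embedding.some else {none}
  have ht : ∏ v ∈ C, ∑ u ∈ S, w v (some u) = ∑ f ∈ Fintype.piFinset t, ∏ v, w v (f v) := by
    rw [← Finset.prod_univ_sum, ← Finset.prod_subset (Finset.subset_univ C)]
    · refine Finset.prod_congr rfl fun v hv => ?_
      simp [t, hv]
    · intro v _ hv
      simp [t, hv, hw]
  rw [ht, Finset.sum_mul_sum, ← Finset.sum_product']
  have hmem : ∀ f, f ∈ Fintype.piFinset t ↔
      (∀ v ∈ C, ∃ u ∈ S, f v = some u) ∧ ∀ v ∉ C, f v = none := by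
    intro f
    rw [Fintype.mem_piFinset]
    constructor
    · intro h
      refine ⟨fun v hv => ?_, fun v hv => ?_⟩
      · have := h v
        simp only [t, hv, if_true, Finset.mem_map] at this
        obtain ⟨u, hu, e⟩ := this
        exact ⟨u, hu, e.symm⟩
      · simpa [t, hv] using h v
    · rintro ⟨h1, h2⟩ v
      by_cases hv : v ∈ C
      · obtain ⟨u, hu, e⟩ := h1 v hv
        simp [t, hv, hu, e]
      · simp [t, hv, h2 v hv]
  refine Finset.sum_bij' (fun p _ => (fun v => if v ∈ C then p v else none,
      fun v => if v ∈ C then none else p v)) (fun fg _ v => if v ∈ C then fg.1 v else fg.2 v)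
      ?_ ?_ ?_ ?_ ?_
  · intro p hp
    obtain ⟨hp, hC⟩ := Finset.mem_filter.1 hp
    obtain ⟨h1, h2, d, hd⟩ := mem_forestMaps.1 hp
    refine Finset.mem_product.2 ⟨(hmem _).2 ⟨fun v hv => ?_, fun v hv => by simp [hv]⟩, ?_⟩
    · simpa [hv] using mem_childrenOf.1 (hC ▸ hv)
    · refine mem_forestMaps.2 ⟨fun v => ?_, fun v u h => ?_, d, fun a b h => ?_⟩
      · by_cases hv : v ∈ C <;> simp [hv, h1 v]
      · by_cases hv : v ∈ C
        · simp [hv] at h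
        · simp only [hv, if_false] at h
          rw [Finset.union_sdiff_of_subset hCT]
          refine (Finset.mem_union.1 (h2 v u h)).resolve_left fun hu => hv ?_
          rw [← hC]
          exact mem_childrenOf.2 ⟨u, hu, h⟩
      · by_cases ha : a ∈ C
        · simp [ha] at h
        · exact hd a b (by simpa [ha] using h)
  · rintro ⟨f, g⟩ hfg
    obtain ⟨hf, hg⟩ := Finset.mem_product.1 hfg
    obtain ⟨hf1, hf2⟩ := (hmem f).1 hf
    obtain ⟨h1, h2, d, hd⟩ := mem_forestMaps.1 hg
    rw [Finset.union_sdiff_of_subset hCT] at h2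
    dsimp only at hf1 hf2 h1 h2 hd ⊢
    -- The rank `d` carries no information on `S`, so the new roots get rank `0` and all other ranks
    -- are raised by one.
    refine Finset.mem_filter.2 ⟨mem_forestMaps.2 ⟨fun v => ?_, fun v u h => ?_,
      fun v => if v ∈ S then 0 else d v + 1, fun a b h => ?_⟩, ?_⟩
    · by_cases hv : v ∈ C
      · obtain ⟨u, -, e⟩ := hf1 v hv
        simp [hv, e, hCT hv]
      · simp [hv, h1 v]
    · by_cases hv : v ∈ C
      · obtain ⟨u', hu', e⟩ := hf1 v hv
        simp only [hv, if_true, e, Option.some.injEq] at h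
        exact Finset.mem_union_left _ (h ▸ hu')
      · exact Finset.mem_union_right _ (h2 v u (by simpa [hv] using h))
    · by_cases ha : a ∈ C
      · obtain ⟨u', hu', e⟩ := hf1 a ha
        simp only [ha, if_true, e, Option.some.injEq] at h
        subst h
        simp [hu', Finset.disjoint_right.1 hST (hCT ha)]
      · simp only [ha, if_false] at h
        have hb := Finset.disjoint_right.1 hST (h2 a b h)
        have haT : a ∈ T := by
          by_contra hh
          rw [(h1 a).2 (fun h' => hh (Finset.mem_sdiff.1 h').1)] at h
          cases h
        simpa [hb, Finset.disjoint_right.1 hST haT] using hd a b h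
    · ext v
      rw [mem_childrenOf]
      by_cases hv : v ∈ C
      · simpa [hv] using hf1 v hv
      · simp only [hv, if_false, iff_false]
        rintro ⟨u, hu, e⟩
        exact Finset.disjoint_right.1 hST (h2 v u e) hu
  · intro p _
    funext v
    by_cases hv : v ∈ C <;> simp [hv]
  · rintro ⟨f, g⟩ hfg
    obtain ⟨hf, hg⟩ := Finset.mem_product.1 hfg
    obtain ⟨-, hf2⟩ := (hmem f).1 hf
    obtain ⟨h1, -⟩ := mem_forestMaps.1 hg
    refine Prod.ext (funext fun v => ?_) (funext fun v => ?_)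
    · by_cases hv : v ∈ C
      · simp [hv]
      · simpa [hv] using (hf2 v hv).symm
    · by_cases hv : v ∈ C
      · simpa [hv] using ((h1 v).2 (by simp [hv])).symm
      · simp [hv]
  · intro p _
    rw [← Finset.prod_mul_distrib]
    refine Finset.prod_congr rfl fun v _ => ?_
    by_cases hv : v ∈ C <;> simp [hv, hw]

/-- The sum over all forests, split by the set of root children. -/
theorem sum_forestMaps_eq_sum_powerset {M : Type*} [AddCommMonoid M] {S T : Finset V}
    (hT : T.Nonempty) (g : (V → Option V) → M) :
    ∑ p ∈ forestMaps S T, g p = ∑ C ∈ T.powerset.filter (·.Nonempty),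
      ∑ p ∈ (forestMaps S T).filter (fun p => childrenOf S p = C), g p :=
  (Finset.sum_fiberwise_of_maps_to (fun _ hp => Finset.mem_filter.2
    ⟨Finset.mem_powerset.2 (childrenOf_subset hp), childrenOf_nonempty hp hT⟩) g).symm

/-- The weight enumerator of forests with given root set, where a nonroot vertex with parent `u`
has weight `x u`. -/
theorem sum_forestMaps_prod {R : Type*} [CommRing R] (x : V → R) (S T : Finset V)
    (hST : Disjoint S T) :
    ∑ p ∈ forestMaps S T, ∏ v, (p v).elim 1 x = forestSum x S T := by
  -- The root set must vary: the smaller forest has root set `C` and nonroot set `T \ C`.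
  induction T using Finset.strongInduction generalizing S with
  | H T ih =>
    rcases T.eq_empty_or_nonempty with rfl | hT
    · simp [forestMaps_empty, forestSum]
    · rw [sum_forestMaps_eq_sum_powerset hT, forestSum, if_neg hT.ne_empty,
        ← sum_pow_mul_forestSum x _ hT, Finset.mul_sum]
      refine Finset.sum_congr rfl fun C hC => ?_
      obtain ⟨hCT, hC⟩ := Finset.mem_filter.1 hC
      rw [Finset.mem_powerset] at hCT
      rw [sum_forestMaps_filter_childrenOf hST hCT (fun _ o => o.elim 1 x) (fun _ => rfl),
        ih _ (Finset.sdiff_ssubset hCT hC) C Finset.disjoint_sdiff, Finset.prod_const, ← mul_assoc,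
        ← pow_succ', Nat.sub_add_cancel hC.card_pos]
      rfl

end ForestMaps

/-! ### The special weight of the least root child -/

/-- The weight factor of a vertex `v` with parent `o`, when `S` is the set of roots and `C` is the
set of children of roots; roots get the factor `1`. -/
def nonrootWeight {V R : Type*} [LinearOrder V] [CommRing R] (s : R) (x : V → R) (S C : Finset V)
    (v : V) (o : Option V) : R :=
  o.elim 1 fun u => if v ∈ C.filter (fun v => ∀ w ∈ C, v ≤ w) then s ^ (S.filter (· < u)).card
    else x u

theorem Finset.filter_forall_le_eq_singleton_min' {V : Type*} [LinearOrder V] {C : Finset V}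
    (hC : C.Nonempty) : C.filter (fun v => ∀ w ∈ C, v ≤ w) = {C.min' hC} := by
  ext v
  rw [Finset.mem_filter, Finset.mem_singleton]
  constructor
  · rintro ⟨h1, h2⟩
    exact le_antisymm (h2 _ (C.min'_mem hC)) (C.min'_le v h1)
  · rintro rfl
    exact ⟨C.min'_mem hC, fun w hw => C.min'_le w hw⟩

/-- The ranks of the possible parents of the least child run once through `0, …, |S| - 1`; every
other child contributes the full sum of `x` over `S`. -/
theorem prod_sum_nonrootWeight {V R : Type*} [LinearOrder V] [CommRing R] (s : R) (x : V → R)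
    (S : Finset V) {C : Finset V} (hC : C.Nonempty) :
    ∏ v ∈ C, ∑ u ∈ S, nonrootWeight s x S C v (some u) =
      qNumber s S.card * (∑ u ∈ S, x u) ^ (C.card - 1) := by
  have hm := C.min'_mem hC
  simp only [nonrootWeight, Option.elim_some, Finset.filter_forall_le_eq_singleton_min' hC,
    Finset.mem_singleton]
  rw [← Finset.mul_prod_erase C _ hm, ← Finset.card_erase_of_mem hm]
  congr 1
  · simp [sum_pow_card_filter_lt]
  · rw [← Finset.prod_const]
    refine Finset.prod_congr rfl fun v hv => ?_
    simp only [if_neg (Finset.ne_of_mem_erase hv)]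

/-- The weight enumerator of forests with given root set, where the least root child is weighted
by the index of its parent among the roots. -/
theorem sum_forestMaps_prod_nonrootWeight {V R : Type*} [LinearOrder V] [Fintype V] [CommRing R]
    (s : R) (x : V → R) {S T : Finset V} (hST : Disjoint S T) (hT : T.Nonempty) :
    ∑ p ∈ forestMaps S T, ∏ v, nonrootWeight s x S (childrenOf S p) v (p v) =
      qNumber s S.card * (∑ u ∈ S, x u + ∑ u ∈ T, x u) ^ (T.card - 1) := by
  rw [sum_forestMaps_eq_sum_powerset hT, ← sum_pow_mul_forestSum x _ hT, Finset.mul_sum]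
  refine Finset.sum_congr rfl fun C hC => ?_
  obtain ⟨hCT, hC⟩ := Finset.mem_filter.1 hC
  rw [Finset.mem_powerset] at hCT
  have h1 : ∀ p ∈ (forestMaps S T).filter (fun p => childrenOf S p = C),
      ∏ v, nonrootWeight s x S (childrenOf S p) v (p v) =
        ∏ v, nonrootWeight s x S C v (p v) := by
    intro p hp
    rw [(Finset.mem_filter.1 hp).2]
  -- Vertices with a parent in the remaining forest lie outside `C`, so the special weight does not
  -- occur there.
  have h2 : ∀ p ∈ forestMaps C (T \ C),
      ∏ v, nonrootWeight s x S C v (p v) = ∏ v, (p v).elim 1 x := by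
    intro p hp
    refine Finset.prod_congr rfl fun v _ => ?_
    cases hv : p v with
    | none => rfl
    | some u =>
      have hvC : v ∉ C := by
        intro h
        rw [((mem_forestMaps.1 hp).1 v).2 (by simp [h])] at hv
        cases hv
      simp [nonrootWeight, hvC]
  rw [Finset.sum_congr rfl h1, sum_forestMaps_filter_childrenOf hST hCT _ (fun _ => rfl),
    Finset.sum_congr rfl h2, sum_forestMaps_prod x _ _ Finset.disjoint_sdiff,
    prod_sum_nonrootWeight s x S hC, mul_assoc]

/-! ### Transfer to rooted forests -/

namespace RootedForest

variable {n : ℕ}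

theorem mem_roots {F : RootedForest n} {v : Fin n} : v ∈ F.roots ↔ F.parent v = none := by
  simp [roots]

theorem mem_withComponents {F : RootedForest n} {k : ℕ} :
    F ∈ withComponents n k ↔ F.roots.card = k := by
  simp [withComponents, components_eq_card_roots]

/-- The number of proper ancestors serves as rank; by acyclicity it drops strictly from a vertex to
its parent. -/
theorem parent_mem_forestMaps (F : RootedForest n) : F.parent ∈ forestMaps F.roots F.rootsᶜ := by
  classical
  refine mem_forestMaps.2 ⟨fun v => by simp [mem_roots], fun v u _ => by simp,
    fun a => (Finset.univ.filter
      fun b => Relation.TransGen (fun a b => F.parent a = some b) a b).card, fun a b h => ?_⟩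
  refine Finset.card_lt_card (Finset.ssubset_iff_of_subset ?_ |>.2 ⟨b, ?_, ?_⟩)
  · intro c hc
    exact Finset.mem_filter.2 ⟨Finset.mem_univ c, (Finset.mem_filter.1 hc).2.head h⟩
  · exact Finset.mem_filter.2 ⟨Finset.mem_univ b, .single h⟩
  · exact fun hb => F.acyclic b (Finset.mem_filter.1 hb).2

theorem rootChildren_eq (F : RootedForest n) : F.rootChildren = childrenOf F.roots F.parent := by
  ext v
  simp [rootChildren, mem_childrenOf]

/-- The forest with a given parent map. -/
def ofForestMap {S : Finset (Fin n)} (p : Fin n → Option (Fin n)) (hp : p ∈ forestMaps S Sᶜ) :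
    RootedForest n where
  parent := p
  acyclic v h := by
    obtain ⟨-, -, d, hd⟩ := mem_forestMaps.1 hp
    have key : ∀ a b, Relation.TransGen (fun a b => p a = some b) a b → d b < d a := by
      intro a b h
      induction h with
      | single h => exact hd _ _ h
      | tail _ h ih => exact (hd _ _ h).trans ih
    exact lt_irrefl _ (key v v h)

theorem sum_filter_roots_eq {M : Type*} [AddCommMonoid M] (S : Finset (Fin n))
    (g : (Fin n → Option (Fin n)) → M) :
    ∑ F : RootedForest n with F.roots = S, g F.parent = ∑ p ∈ forestMaps S Sᶜ, g p := by
  refine Finset.sum_bij' (fun F _ => F.parent) (fun p hp => ofForestMap p hp) ?_ ?_ ?_ ?_ ?_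
  · intro F hF
    obtain rfl := (Finset.mem_filter.1 hF).2
    exact F.parent_mem_forestMaps
  · intro p hp
    refine Finset.mem_filter.2 ⟨Finset.mem_univ _, ?_⟩
    ext v
    rw [mem_roots]
    exact ((mem_forestMaps.1 hp).1 v).trans (by simp)
  · exact fun _ _ => rfl
  · exact fun _ _ => rfl
  · exact fun _ _ => rfl

theorem mem_minRootChild {F : RootedForest n} {v : Fin n} :
    v ∈ F.minRootChild ↔ v ∈ childrenOf F.roots F.parent ∧
      ∀ w ∈ childrenOf F.roots F.parent, v ≤ w := by
  simp [minRootChild, rootChildren_eq]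

theorem exists_minRootChild_eq (F : RootedForest n) (h : F.rootsᶜ.Nonempty) :
    ∃ m u, F.minRootChild = {m} ∧ u ∈ F.roots ∧ F.parent m = some u := by
  have hne := childrenOf_nonempty F.parent_mem_forestMaps h
  obtain ⟨u, hu, e⟩ := mem_childrenOf.1 (Finset.min'_mem _ hne)
  refine ⟨_, u, ?_, hu, e⟩
  rw [← Finset.filter_forall_le_eq_singleton_min' hne]
  ext v
  simp only [mem_minRootChild, Finset.mem_filter]

/-- Separates the factor determined by the root set from the one summed over parent maps. As `u :
Fin n` has label `u + 1`, the exponent `parent - 1` is `u` itself. -/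
theorem vertexWeight_eq {R : Type*} [CommRing R] (r s t : R) (F : RootedForest n) (v : Fin n) :
    F.vertexWeight r s t v = (if v ∈ F.roots then r ^ (F.lowerNonroots v).card else 1) *
      nonrootWeight s (fun u : Fin n => t ^ (u : ℕ)) F.roots (childrenOf F.roots F.parent) v
        (F.parent v) := by
  rw [vertexWeight]
  cases hv : F.parent v with
  | none => simp [mem_roots.2 hv, nonrootWeight]
  | some u =>
    have hr : v ∉ F.roots := by simp [mem_roots, hv]
    rw [if_neg hr, if_neg hr, one_mul, nonrootWeight, Option.elim_some]
    simp only [Finset.mem_filter, ← mem_minRootChild]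
    by_cases hm : v ∈ F.minRootChild
    · obtain ⟨m, -, e, -⟩ := F.exists_minRootChild_eq ⟨v, Finset.mem_compl.2 hr⟩
      obtain rfl : v = m := by simpa [e] using hm
      rw [if_pos hm, if_pos hm, scindex, e, Finset.sum_singleton]
      simp [parentLabel, hv]
    · rw [if_neg hm, if_neg hm]
      simp [parentLabel, hv]

theorem weight_eq_mul_prod {R : Type*} [CommRing R] (r s t : R) (F : RootedForest n) :
    F.weight r s t = r ^ F.niblings *
      ∏ v, nonrootWeight s (fun u : Fin n => t ^ (u : ℕ)) F.roots (childrenOf F.roots F.parent) v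
        (F.parent v) := by
  simp only [weight, vertexWeight_eq, Finset.prod_mul_distrib]
  rw [Finset.prod_ite_mem, Finset.univ_inter, Finset.prod_pow_eq_pow_sum, niblings]

/-- There are `n - k - 1` vertices in `V_t(F)`, each with parent label at least `1`. The additive
form avoids truncated subtraction and shows that the exponent of `t` is nonnegative. -/
theorem parents_eq (F : RootedForest n) (h : F.rootsᶜ.Nonempty) :
    F.parents + F.roots.card + 1 = n + ∑ v ∈ F.otherVertices, (F.parentLabel v - 1) := by
  obtain ⟨m, u, e, -, hm⟩ := F.exists_minRootChild_eq h
  have hmr : m ∈ F.rootsᶜ := by simp [mem_roots, hm]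
  have ho : F.otherVertices = F.rootsᶜ.erase m := by
    ext v
    simp [otherVertices, e, and_comm]
  have hc : F.otherVertices.card + F.roots.card + 1 = n := by
    rw [ho, Finset.card_erase_of_mem hmr]
    have h1 := Finset.card_pos.2 h
    have h2 := F.roots.card_add_card_compl
    rw [Fintype.card_fin] at h2
    omega
  have hp : F.parents = ∑ v ∈ F.otherVertices, (F.parentLabel v - 1) + F.otherVertices.card := by
    rw [parents, Finset.card_eq_sum_ones, ← Finset.sum_add_distrib]
    refine Finset.sum_congr rfl fun v hv => ?_
    rw [ho] at hv
    have hvr : F.parent v ≠ none := by simpa [mem_roots] using Finset.mem_of_mem_erase hv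
    obtain ⟨u, hu⟩ := Option.ne_none_iff_exists'.1 hvr
    simp [parentLabel, hu]
  omega

theorem weight_eq {R : Type*} [CommRing R] (r s t : R) (F : RootedForest n)
    (h : F.rootsᶜ.Nonempty) :
    F.weight r s t =
      r ^ F.niblings * s ^ F.scindex * t ^ (F.parents + F.roots.card + 1 - n) := by
  obtain ⟨m, u, e, -, hm⟩ := F.exists_minRootChild_eq h
  have hmr : m ∈ F.rootsᶜ := by simp [mem_roots, hm]
  have ho : F.otherVertices = F.rootsᶜ.erase m := by
    ext v
    simp [otherVertices, e, and_comm]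
  rw [F.parents_eq h, Nat.add_sub_cancel_left, weight, ← Finset.prod_mul_prod_compl F.roots,
    ← Finset.mul_prod_erase _ _ hmr, niblings, ← Finset.prod_pow_eq_pow_sum, mul_assoc,
    ← Finset.prod_pow_eq_pow_sum, ho]
  congr 1
  · exact Finset.prod_congr rfl fun v hv => if_pos hv
  · congr 1
    · rw [vertexWeight, if_neg (Finset.mem_compl.1 hmr), if_pos (by simp [e])]
    · refine Finset.prod_congr rfl fun v hv => ?_
      rw [vertexWeight, if_neg (Finset.mem_compl.1 (Finset.mem_of_mem_erase hv)),
        if_neg (by simpa [e] using Finset.ne_of_mem_erase hv)]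

theorem sum_weight {R : Type*} [CommRing R] {k : ℕ} (r s t : R) (hk : k < n) :
    ∑ F ∈ withComponents n k, F.weight r s t =
      qBinomial r n k * qNumber s k * qNumber t n ^ (n - k - 1) := by
  have hmaps : ∀ F ∈ withComponents n k, F.roots ∈ Finset.univ.powersetCard k := fun F hF =>
    Finset.mem_powersetCard.2 ⟨Finset.subset_univ _, mem_withComponents.1 hF⟩
  have hb := inversionSum_eq_qBinomial r (Finset.univ : Finset (Fin n)) (k := k)
    (by simpa using hk.le)
  rw [Finset.card_univ, Fintype.card_fin] at hb
  rw [← Finset.sum_fiberwise_of_maps_to hmaps, ← hb, inversionSum, mul_assoc, Finset.sum_mul]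
  refine Finset.sum_congr rfl fun S hS => ?_
  have hc := (Finset.mem_powersetCard.1 hS).2
  have hf : (withComponents n k).filter (fun F => F.roots = S) =
      Finset.univ.filter fun F => F.roots = S := by
    ext F
    simp only [Finset.mem_filter, mem_withComponents, Finset.mem_univ, true_and]
    exact ⟨fun h => h.2, fun h => ⟨h ▸ hc, h⟩⟩
  have hw : ∀ F ∈ Finset.univ.filter (fun F : RootedForest n => F.roots = S),
      F.weight r s t = r ^ (∑ v ∈ S, ((Finset.univ \ S).filter (· < v)).card) *
        ∏ v, nonrootWeight s (fun u : Fin n => t ^ (u : ℕ)) S (childrenOf S F.parent) v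
          (F.parent v) := by
    intro F hF
    obtain rfl := (Finset.mem_filter.1 hF).2
    rw [weight_eq_mul_prod]
    congr 2
    refine Finset.sum_congr rfl fun v _ => congrArg _ ?_
    ext w
    simp [lowerNonroots]
  have hcc : Sᶜ.card = n - k := by rw [Finset.card_compl, Fintype.card_fin, hc]
  have hne : Sᶜ.Nonempty := Finset.card_pos.1 (by omega)
  -- The sums of `t ^ u` over `S` and over `Sᶜ` combine to `[n]_t`.
  rw [hf, Finset.sum_congr rfl hw, ← Finset.mul_sum, sum_filter_roots_eq S fun p =>
    ∏ v, nonrootWeight s (fun u : Fin n => t ^ (u : ℕ)) S (childrenOf S p) v (p v),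
    sum_forestMaps_prod_nonrootWeight s _ disjoint_compl_right hne, hc, hcc,
    Finset.sum_add_sum_compl, Fin.sum_univ_eq_sum_range (fun i => t ^ i) n]
  rfl

/-- Only the edgeless forest occurs, and no root has a lower nonroot. -/
theorem sum_weight_self {R : Type*} [CommRing R] (r s t : R) :
    ∑ F ∈ withComponents n n, F.weight r s t = 1 := by
  have hr : ∀ F ∈ withComponents n n, F.roots = Finset.univ := fun F hF =>
    Finset.card_eq_iff_eq_univ _ |>.1 ((mem_withComponents.1 hF).trans (Fintype.card_fin n).symm)
  have hw : ∀ F ∈ withComponents n n, F.weight r s t = 1 := fun F hF =>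
    Finset.prod_eq_one fun v _ => by simp [vertexWeight, lowerNonroots, hr F hF]
  have h1 : withComponents n n =
      Finset.univ.filter fun F : RootedForest n => F.roots = Finset.univ := by
    ext F
    rw [Finset.mem_filter]
    refine ⟨fun h => ⟨Finset.mem_univ _, hr F h⟩, fun h => mem_withComponents.2 ?_⟩
    rw [h.2, Finset.card_univ, Fintype.card_fin]
  rw [Finset.sum_congr rfl hw, h1, sum_filter_roots_eq _ fun _ => (1 : R), Finset.compl_univ,
    forestMaps_empty, Finset.sum_singleton]

theorem withComponents_eq_empty {k : ℕ} (hk : n < k) : withComponents n k = ∅ := by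
  refine Finset.eq_empty_of_forall_notMem fun F hF => ?_
  have h1 := Finset.card_le_univ F.roots
  rw [mem_withComponents.1 hF, Fintype.card_fin] at h1
  omega

end RootedForest

/-! ### The `q`-forests matrix -/

theorem qForestsEntry_self {R : Type*} [CommRing R] (q : R) (n : ℕ) : qForestsEntry q n n = 1 := by
  rcases eq_or_ne n 0 with rfl | h
  · simp [qForestsEntry]
  · rw [qForestsEntry, if_neg h, if_pos le_rfl, qBinomial_self, Nat.sub_self, pow_zero, mul_one]

/-- For `k = 0` both sides vanish, as `[0]_q = 0`. Otherwise absorption trades `[k]_q` for one more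
factor `[n]_q`. -/
theorem qForestsEntry_of_lt {R : Type*} [CommRing R] (q : R) {n k : ℕ} (hk : k < n) :
    qForestsEntry q n k = qBinomial q n k * qNumber q k * qNumber q n ^ (n - k - 1) := by
  cases k with
  | zero => simp [qForestsEntry, qNumber_zero, hk.ne']
  | succ k =>
    obtain ⟨n, rfl⟩ : ∃ m, n = m + 1 := ⟨n - 1, by omega⟩
    obtain ⟨e, he⟩ : ∃ e, n + 1 - (k + 1) = e + 1 := ⟨n - k - 1, by omega⟩
    rw [qForestsEntry, if_neg (Nat.succ_ne_zero k), if_pos hk.le, he, Nat.add_sub_cancel,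
      Nat.add_sub_cancel, Nat.add_sub_cancel, qBinomial_succ_mul_qNumber q (by omega), pow_succ]
    ring

theorem proposition3p1 {R : Type*} [CommRing R] (n k : ℕ) (r s t q : R) :
    (k < n →
      (∀ F ∈ RootedForest.withComponents n k,
        n ≤ F.parents + k + 1 ∧
        F.weight r s t = r ^ F.niblings * s ^ F.scindex * t ^ (F.parents + k + 1 - n)) ∧
      ∑ F ∈ RootedForest.withComponents n k,
          r ^ F.niblings * s ^ F.scindex * t ^ (F.parents + k + 1 - n) =
        qBinomial r n k * qNumber s k * qNumber t n ^ (n - k - 1) ∧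
      qForestsEntry q n k =
        ∑ F ∈ RootedForest.withComponents n k,
          q ^ (F.niblings + F.scindex + (F.parents + k + 1 - n))) ∧
    qForestsEntry q n k = ∑ F ∈ RootedForest.withComponents n k, F.weight q q q := by
  have hne : k < n → ∀ F ∈ RootedForest.withComponents n k, F.rootsᶜ.Nonempty := by
    intro hk F hF
    rw [← Finset.card_pos, Finset.card_compl, RootedForest.mem_withComponents.1 hF,
      Fintype.card_fin]
    omega
  have hw : k < n → ∀ r s t : R, ∀ F ∈ RootedForest.withComponents n k, F.weight r s t =
      r ^ F.niblings * s ^ F.scindex * t ^ (F.parents + k + 1 - n) := by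
    intro hk r s t F hF
    have := F.weight_eq r s t (hne hk F hF)
    rwa [RootedForest.mem_withComponents.1 hF] at this
  refine ⟨fun hk => ⟨fun F hF => ⟨?_, hw hk r s t F hF⟩, ?_, ?_⟩, ?_⟩
  · have := F.parents_eq (hne hk F hF)
    rw [RootedForest.mem_withComponents.1 hF] at this
    omega
  · rw [← Finset.sum_congr rfl (hw hk r s t), RootedForest.sum_weight r s t hk]
  · rw [qForestsEntry_of_lt q hk, ← RootedForest.sum_weight q q q hk]
    refine Finset.sum_congr rfl fun F hF => ?_
    rw [hw hk q q q F hF, pow_add, pow_add]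
  · rcases lt_trichotomy k n with hk | rfl | hk
    · rw [qForestsEntry_of_lt q hk, RootedForest.sum_weight q q q hk]
    · rw [qForestsEntry_self, RootedForest.sum_weight_self]
    · rw [RootedForest.withComponents_eq_empty hk, Finset.sum_empty, qForestsEntry,
        if_neg (by omega), if_neg hk.not_ge]
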